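/- An (abstract) simplicial complex $K$ is a family of nonempty finite subsets (simplices) of a set $S_K$, closed under passing to nonempty subsets; the empty set is also regarded as a degenerate simplex of $K$. The space $|K|_m$ is the set of all finitely supported functions $x:S_K\to[0,1]$ with $\sum_{v}x_v=1$ and $\{v : x_v>0\}\in K$ (barycentric coordinates), with the metric $d(x,y)=\sum_{v}|x_v-y_v|$. For simplicial complexes $K,L$ on disjoint sets $S_K,S_L$, the join $K*L$ is the simplicial complex on $S_K\cup S_L$ whose simplices are the nonempty finite sets $T\subseteq S_K\cup S_L$ such that $T\cap S_K$ is a simplex of $K$ or empty and $T\cap S_L$ is a simplex of $L$ or empty. A space $Y$ is an absolute extensor of a space $X$ if for every closed subset $C\subseteq X$ (possibly empty) each continuous map $C\to Y$ extends to a continuous map $X\to Y$. **Corollary 6.13.** Let $X$ be a metrizable space, let $A,B\subseteq X$ be arbitrary subsets with $X=A\cup B$, and let $K,L$ be simplicial complexes (with disjoint vertex sets). If $|K|_m$ is an absolute extensor of $A$ and $|L|_m$ is an absolute extensor of $B$ (with the subspace topologies), then $|K*L|_m$ is an absolute extensor of $X$. -/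

import Mathlib

/-- Faces of the join of two abstract simplicial complexes. The disjoint union of the two vertex
sets is the sum type `ι ⊕ κ`; a nonempty finite `T` is a face when its part in `ι` and its part in
`κ` are faces. As in Mathlib, `faces` lists nonempty simplices only, and the empty set counts as a
(degenerate) simplex of every complex, so an empty part imposes no condition. -/
def PreAbstractSimplicialComplex.join {ι κ : Type*} (K : PreAbstractSimplicialComplex ι)
    (L : PreAbstractSimplicialComplex κ) : PreAbstractSimplicialComplex (ι ⊕ κ) where
  faces := {T | T.Nonempty ∧ (T.toLeft = ∅ ∨ T.toLeft ∈ K.faces) ∧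
    (T.toRight = ∅ ∨ T.toRight ∈ L.faces)}
  isRelLowerSet_faces := by
    rintro T ⟨hT, hK, hL⟩
    refine ⟨hT, fun U hUT hU => ⟨hU, ?_, ?_⟩⟩
    · have hsub : U.toLeft ⊆ T.toLeft := Finset.toLeft_subset_toLeft hUT
      rcases U.toLeft.eq_empty_or_nonempty with h | h
      · exact Or.inl h
      · rcases hK with h0 | h1
        · rw [h0] at hsub
          exact Or.inl (Finset.subset_empty.1 hsub)
        · exact Or.inr ((K.isRelLowerSet_faces h1).2 hsub h)
    · have hsub : U.toRight ⊆ T.toRight := Finset.toRight_subset_toRight hUT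
      rcases U.toRight.eq_empty_or_nonempty with h | h
      · exact Or.inl h
      · rcases hL with h0 | h1
        · rw [h0] at hsub
          exact Or.inl (Finset.subset_empty.1 hsub)
        · exact Or.inr ((L.isRelLowerSet_faces h1).2 hsub h)

/-- The carrier `|K|` of a simplicial complex: a point is given by its barycentric coordinates,
which are nonnegative, add up to `1`, and are positive exactly on the vertices of a simplex
of `K`. -/
def PreAbstractSimplicialComplex.MetricCarrier {ι : Type*}
    (K : PreAbstractSimplicialComplex ι) : Type _ :=
  {x : ι →₀ ℝ // (∀ v, 0 ≤ x v) ∧ (x.sum fun _ a => a) = 1 ∧ x.support ∈ K.faces}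

namespace PreAbstractSimplicialComplex.MetricCarrier

variable {ι : Type*} {K : PreAbstractSimplicialComplex ι}

/-- The distance on `|K|_m`: the sum over all vertices `v` of `|x_v - y_v|`. -/
noncomputable instance : Dist K.MetricCarrier where
  dist x y := (x.1 - y.1).sum fun _ a => |a|

theorem dist_eq_sum (x y : K.MetricCarrier) (s : Finset ι) (hs : (x.1 - y.1).support ⊆ s) :
    dist x y = ∑ v ∈ s, |x.1 v - y.1 v| := by
  change (x.1 - y.1).sum (fun _ a => |a|) = _
  rw [Finsupp.sum_of_support_subset _ hs _ (fun _ _ => abs_zero)]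
  rfl

/-- The metric space `|K|_m`. Its topology is the metric one. -/
noncomputable instance : MetricSpace K.MetricCarrier where
  dist_self x := by
    change (x.1 - x.1).sum (fun _ a => |a|) = 0
    simp
  dist_comm x y := by
    classical
    rw [dist_eq_sum x y ((x.1 - y.1).support ∪ (y.1 - x.1).support) Finset.subset_union_left,
      dist_eq_sum y x ((x.1 - y.1).support ∪ (y.1 - x.1).support) Finset.subset_union_right]
    exact Finset.sum_congr rfl fun v _ => abs_sub_comm _ _
  dist_triangle x y z := by
    classical
    have h1 : (x.1 - z.1).support ⊆
        (x.1 - z.1).support ∪ ((x.1 - y.1).support ∪ (y.1 - z.1).support) :=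
      Finset.subset_union_left
    have h2 : (x.1 - y.1).support ⊆
        (x.1 - z.1).support ∪ ((x.1 - y.1).support ∪ (y.1 - z.1).support) :=
      Finset.subset_union_left.trans Finset.subset_union_right
    have h3 : (y.1 - z.1).support ⊆
        (x.1 - z.1).support ∪ ((x.1 - y.1).support ∪ (y.1 - z.1).support) :=
      Finset.subset_union_right.trans Finset.subset_union_right
    rw [dist_eq_sum x z _ h1, dist_eq_sum x y _ h2, dist_eq_sum y z _ h3,
      ← Finset.sum_add_distrib]
    exact Finset.sum_le_sum fun v _ => abs_sub_le _ _ _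
  eq_of_dist_eq_zero := by
    intro x y h
    rw [dist_eq_sum x y _ subset_rfl,
      Finset.sum_eq_zero_iff_of_nonneg (fun _ _ => abs_nonneg _)] at h
    apply Subtype.ext
    ext v
    by_cases hv : v ∈ (x.1 - y.1).support
    · exact sub_eq_zero.1 (abs_eq_zero.1 (h v hv))
    · exact sub_eq_zero.1 (Finsupp.notMem_support_iff.1 hv)

end PreAbstractSimplicialComplex.MetricCarrier

/-- `Y` is an absolute extensor of `X`: every continuous map from a closed subset of `X` to `Y`
extends continuously over `X`. -/
def IsAbsoluteExtensorOf (Y X : Type*) [TopologicalSpace Y] [TopologicalSpace X] : Prop :=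
  ∀ C : Set X, IsClosed C → ∀ f : C(C, Y), ∃ g : C(X, Y), ∀ c : C, g c = f c

/-! A map from `C` to `|K * L|_m` amounts to a weight `σ : C → [0, 1]`, a map to `|K|_m` where `σ ≠
0` and a map to `|L|_m` where `σ ≠ 1`. The `K`-part lives on a relatively closed subset `C ∩ U₀` of
the open set `U₀ = X \ {x ∈ C | σ x = 0}`. It extends to a map `G` on an open `W₀ ⊇ (C ∪ A) ∩ U₀`;
likewise the `L`-part extends to `H` on an open `W₁ ⊇ (C ∪ B) ∩ U₁`. Since `A ∪ B = X`, the sets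
`W₀`, `W₁` cover `X`. Tietze then extends `σ` to `α : X → [0, 1]` that is `0` off `W₀` and `1` off
`W₁`, and `α G + (1 - α) H` is the required extension (`ExtendsOver.join`).

The crux is to pass from the arbitrary set `A` to an open set
(`ExtendsOver.exists_isOpen_extension`). A map on `A` need not extend to a neighbourhood of `A`, but
it is contiguous to one that does (`BarycentricOn.exists_contiguous_nhds`). Near the closed set the
original map extends anyway (`BarycentricOn.exists_nhds_extension`), and contiguity allows a linear
interpolation inside `|K|`. `ExtendsOver.inter_isOpen` makes all this available in `U₀` and `U₁`.

Maps on a set `S` are handled as coordinate functions on all of `X` with arbitrary values off `S`.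
This is legitimate because continuity into `|K|_m` is continuity of each coordinate. -/

open Filter Topology Set

/-! ### Barycentric coordinates and coordinatewise continuity. -/

namespace PreAbstractSimplicialComplex

variable {ι : Type*} {K L : PreAbstractSimplicialComplex ι} {X : Type*}

/-- `φ` is the family of barycentric coordinates of a point of `|K|`. -/
structure IsBarycentric (K : PreAbstractSimplicialComplex ι) (φ : ι → ℝ) : Prop where
  nonneg : ∀ v, 0 ≤ φ v
  exists_face : ∃ s ∈ K.faces, (∀ v ∉ s, φ v = 0) ∧ ∑ v ∈ s, φ v = 1

namespace IsBarycentric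

variable {φ : ι → ℝ}

theorem sum_eq_one (h : K.IsBarycentric φ) {s : Finset ι} (hs : ∀ v ∉ s, φ v = 0) :
    ∑ v ∈ s, φ v = 1 := by
  classical
  obtain ⟨t, -, ht0, ht1⟩ := h.exists_face
  rw [← ht1, Finset.sum_subset (Finset.subset_union_left (s₂ := t)) fun v _ hv => hs v hv,
    ← Finset.sum_subset (Finset.subset_union_right (s₁ := s)) fun v _ hv => ht0 v hv]

theorem sum_le_one (h : K.IsBarycentric φ) (s : Finset ι) : ∑ v ∈ s, φ v ≤ 1 := by
  classical
  obtain ⟨t, -, ht0, -⟩ := h.exists_face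
  rw [← h.sum_eq_one (s := s ∪ t) fun v hv => ht0 v (by simp_all)]
  exact Finset.sum_le_sum_of_subset_of_nonneg Finset.subset_union_left fun v _ _ => h.nonneg v

theorem le_one (h : K.IsBarycentric φ) (v : ι) : φ v ≤ 1 := by
  simpa using h.sum_le_one {v}

theorem mono (h : K.IsBarycentric φ) (hKL : K.faces ⊆ L.faces) : L.IsBarycentric φ :=
  ⟨h.nonneg, h.exists_face.imp fun _ hs => ⟨hKL hs.1, hs.2⟩⟩

theorem exists_toCarrier (h : K.IsBarycentric φ) : ∃ p : K.MetricCarrier, ⇑p.1 = φ := by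
  classical
  obtain ⟨s, hs, h0, h1⟩ := h.exists_face
  have hsub : (Finsupp.onFinset s φ fun v hv => by_contra fun hn => hv (h0 v hn)).support ⊆ s :=
    Finsupp.support_onFinset_subset
  have hsum : (Finsupp.onFinset s φ fun v hv => by_contra fun hn => hv (h0 v hn)).sum
      (fun _ a => a) = 1 := by
    rw [Finsupp.sum_of_support_subset _ hsub _ fun _ _ => rfl]
    simpa using h1
  refine ⟨⟨Finsupp.onFinset s φ fun v hv => by_contra fun hn => hv (h0 v hn), h.nonneg, hsum,
    (K.isRelLowerSet_faces hs).2 hsub ?_⟩, rfl⟩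
  rw [Finset.nonempty_iff_ne_empty]
  intro he
  rw [Finsupp.sum, he] at hsum
  simp at hsum

/-- The point of `|K|` with barycentric coordinates `φ`. -/
noncomputable def toCarrier (h : K.IsBarycentric φ) : K.MetricCarrier :=
  h.exists_toCarrier.choose

theorem toCarrier_apply (h : K.IsBarycentric φ) (v : ι) : h.toCarrier.1 v = φ v :=
  congrFun h.exists_toCarrier.choose_spec v

end IsBarycentric

namespace MetricCarrier

theorem isBarycentric (p : K.MetricCarrier) : K.IsBarycentric p.1 :=
  ⟨p.2.1, p.1.support, p.2.2.2, fun _ hv => Finsupp.notMem_support_iff.1 hv, p.2.2.1⟩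

theorem ext_apply {p q : K.MetricCarrier} (h : ∀ v, p.1 v = q.1 v) : p = q :=
  Subtype.ext (Finsupp.ext h)

theorem abs_apply_sub_le_dist (p q : K.MetricCarrier) (v : ι) : |p.1 v - q.1 v| ≤ dist p q := by
  classical
  rw [dist_eq_sum p q (insert v (p.1 - q.1).support) (Finset.subset_insert _ _)]
  exact Finset.single_le_sum (f := fun v => |p.1 v - q.1 v|) (fun _ _ => abs_nonneg _)
    (Finset.mem_insert_self _ _)

theorem continuous_apply (v : ι) : Continuous fun p : K.MetricCarrier => p.1 v :=
  (LipschitzWith.of_dist_le_mul (K := 1) fun p q => by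
    simpa [Real.dist_eq] using abs_apply_sub_le_dist p q v).continuous

theorem dist_le_sum_add (p q : K.MetricCarrier) (s : Finset ι) (hs : ∀ v ∉ s, q.1 v = 0) :
    dist p q ≤ ∑ v ∈ s, |p.1 v - q.1 v| + (1 - ∑ v ∈ s, p.1 v) := by
  classical
  have h1 := p.isBarycentric.sum_eq_one (s := s ∪ p.1.support)
    fun v hv => Finsupp.notMem_support_iff.1 (by simp_all)
  rw [← Finset.sum_sdiff (Finset.subset_union_left (s₁ := s) (s₂ := p.1.support))] at h1
  rw [dist_eq_sum p q (s ∪ p.1.support),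
    ← Finset.sum_sdiff (Finset.subset_union_left (s₁ := s) (s₂ := p.1.support))]
  · have : ∑ v ∈ (s ∪ p.1.support) \ s, |p.1 v - q.1 v| = ∑ v ∈ (s ∪ p.1.support) \ s, p.1 v :=
      Finset.sum_congr rfl fun v hv => by
        rw [hs v (Finset.mem_sdiff.1 hv).2, sub_zero, abs_of_nonneg (p.2.1 v)]
    rw [this]
    linarith
  · intro v hv
    by_contra hn
    simp only [Finset.mem_union, not_or, Finsupp.notMem_support_iff] at hn
    exact Finsupp.mem_support_iff.1 hv (by simp [hn.2, hs v hn.1])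

/-- The total mass is 1, so convergence on the finite support of the limit forces the mass elsewhere
to tend to 0. This gives convergence in the sum metric. -/
theorem continuous_of_continuous_apply [TopologicalSpace X] {F : X → K.MetricCarrier}
    (h : ∀ v, Continuous fun x => (F x).1 v) : Continuous F := by
  rw [continuous_iff_continuousAt]
  intro x
  set s := (F x).1.support
  have hs : ∀ v ∉ s, (F x).1 v = 0 := fun v hv => Finsupp.notMem_support_iff.1 hv
  rw [ContinuousAt, tendsto_iff_dist_tendsto_zero]
  have hc : Continuous fun y => ∑ v ∈ s, |(F y).1 v - (F x).1 v| + (1 - ∑ v ∈ s, (F y).1 v) := by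
    have := fun v => h v
    fun_prop
  have := hc.tendsto x
  simp only [sub_self, abs_zero, Finset.sum_const_zero,
    (F x).isBarycentric.sum_eq_one hs, add_zero] at this
  exact squeeze_zero (fun _ => dist_nonneg) (fun y => dist_le_sum_add _ _ s hs) this

end MetricCarrier

/-- The functions `fun x => φ x v` are, on `S`, the barycentric coordinates of a continuous map
to `|K|_m`. -/
structure BarycentricOn [TopologicalSpace X] (K : PreAbstractSimplicialComplex ι)
    (φ : X → ι → ℝ) (S : Set X) : Prop where
  isBarycentric : ∀ x ∈ S, K.IsBarycentric (φ x)
  continuousOn : ∀ v, ContinuousOn (fun x => φ x v) S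

end PreAbstractSimplicialComplex

/-! ### Gluing, cutting off and summing coordinate families. -/

theorem ContinuousOn.union_of_isClosed_inter {X Y : Type*} [TopologicalSpace X]
    [TopologicalSpace Y] {f : X → Y} {S F G : Set X} (hF : IsClosed F) (hG : IsClosed G)
    (hf : ContinuousOn f (S ∩ F)) (hg : ContinuousOn f (S ∩ G)) :
    ContinuousOn f (S ∩ (F ∪ G)) := by
  -- At a point outside the closed set `H`, continuity within `S ∩ H` is vacuous.
  have key : ∀ H : Set X, IsClosed H → ContinuousOn f (S ∩ H) → ∀ x ∈ S,
      ContinuousWithinAt f (S ∩ H) x := by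
    intro H hH hc x hx
    by_cases h : x ∈ H
    · exact hc x ⟨hx, h⟩
    · exact continuousWithinAt_of_notMem_closure fun hn =>
        h (hH.closure_subset_iff.2 inter_subset_right hn)
  intro x hx
  rw [inter_union_distrib_left]
  exact (key F hF hf x hx.1).union (key G hG hg x hx.1)

/-- A function that vanishes off an open set cuts off a bounded function on that set. -/
theorem Continuous.mul_of_continuousOn_of_abs_le_one {X : Type*} [TopologicalSpace X]
    {α φ : X → ℝ} {O : Set X} (hα : Continuous α) (hO : IsOpen O) (h0 : ∀ x ∉ O, α x = 0)
    (hφ : ContinuousOn φ O) (h1 : ∀ x ∈ O, |φ x| ≤ 1) : Continuous fun x => α x * φ x := by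
  rw [continuous_iff_continuousAt]
  intro x
  by_cases hx : x ∈ O
  · exact hα.continuousAt.mul (hφ.continuousAt (hO.mem_nhds hx))
  · have hαx := h0 x hx
    rw [ContinuousAt, hαx, zero_mul]
    refine squeeze_zero_norm (a := fun y => |α y|) (fun y => ?_) ?_
    · by_cases hy : y ∈ O
      · rw [Real.norm_eq_abs, abs_mul]
        exact mul_le_of_le_one_right (abs_nonneg _) (h1 y hy)
      · simp [h0 y hy]
    · simpa [hαx] using hα.abs.tendsto x

namespace PreAbstractSimplicialComplex

variable {ι : Type*} {K L : PreAbstractSimplicialComplex ι} {X Y : Type*} [TopologicalSpace X]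
  [TopologicalSpace Y]

namespace BarycentricOn

variable {φ ψ : X → ι → ℝ} {S T : Set X}

theorem mono (h : K.BarycentricOn φ S) (hT : T ⊆ S) : K.BarycentricOn φ T :=
  ⟨fun x hx => h.isBarycentric x (hT hx), fun v => (h.continuousOn v).mono hT⟩

theorem congr (h : K.BarycentricOn φ S) (hψ : EqOn ψ φ S) : K.BarycentricOn ψ S :=
  ⟨fun x hx => hψ hx ▸ h.isBarycentric x hx,
    fun v => (h.continuousOn v).congr fun _ hx => congrFun (hψ hx) v⟩

theorem comp (h : K.BarycentricOn φ S) {f : Y → X} (hf : Continuous f) :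
    K.BarycentricOn (φ ∘ f) (f ⁻¹' S) :=
  ⟨fun x hx => h.isBarycentric (f x) hx,
    fun v => (h.continuousOn v).comp hf.continuousOn fun _ hx => hx⟩

theorem union_of_isClosed {F G : Set X} (hF : IsClosed F) (hG : IsClosed G)
    (h : K.BarycentricOn φ (S ∩ F)) (h' : K.BarycentricOn φ (S ∩ G)) :
    K.BarycentricOn φ (S ∩ (F ∪ G)) :=
  ⟨fun x hx => hx.2.elim (fun h1 => h.isBarycentric x ⟨hx.1, h1⟩)
      fun h1 => h'.isBarycentric x ⟨hx.1, h1⟩,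
    fun v => (h.continuousOn v).union_of_isClosed_inter hF hG (h'.continuousOn v)⟩

open Classical in
theorem ite_of_isClosed {F G : Set X} (hF : IsClosed F) (hG : IsClosed G)
    (h : K.BarycentricOn φ (S ∩ F)) (h' : K.BarycentricOn ψ (S ∩ G))
    (heq : EqOn φ ψ (S ∩ F ∩ G)) :
    K.BarycentricOn (fun x => if x ∈ F then φ x else ψ x) (S ∩ (F ∪ G)) := by
  refine union_of_isClosed hF hG (h.congr fun x hx => if_pos hx.2) (h'.congr fun x hx => ?_)
  by_cases hxF : x ∈ F
  · simpa [hxF] using heq ⟨⟨hx.1, hxF⟩, hx.2⟩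
  · simp [hxF]

/-- Dominated convergence for families bounded by barycentric coordinates. -/
theorem continuousOn_finsum (h : K.BarycentricOn φ S) {G : X → ι → ℝ}
    (hG : ∀ v, ContinuousOn (fun x => G x v) S) (h0 : ∀ x ∈ S, ∀ v, 0 ≤ G x v)
    (hle : ∀ x ∈ S, ∀ v, G x v ≤ φ x v) : ContinuousOn (fun x => ∑ᶠ v, G x v) S := by
  classical
  intro x hx
  obtain ⟨s, -, hs, hs1⟩ := (h.isBarycentric x hx).exists_face
  have hsum : ∀ y ∈ S, ∀ t : Finset ι, (∀ v ∉ t, φ y v = 0) → ∑ᶠ v, G y v = ∑ v ∈ t, G y v := by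
    intro y hy t ht
    refine finsum_eq_sum_of_support_subset _ fun v hv => ?_
    by_contra hn
    exact hv (le_antisymm (ht v hn ▸ hle y hy v) (h0 y hy v))
  -- The tail of `G y` off `s` is dominated by that of `φ y`, which is `1 - ∑ v ∈ s, φ y v` and
  -- tends to 0 as `y` tends to `x`.
  have hbd : ∀ y ∈ S, ∑ v ∈ s, G y v ≤ ∑ᶠ v, G y v ∧
      ∑ᶠ v, G y v ≤ ∑ v ∈ s, G y v + (1 - ∑ v ∈ s, φ y v) := by
    intro y hy
    obtain ⟨t, -, ht, -⟩ := (h.isBarycentric y hy).exists_face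
    have ht' : ∀ v ∉ s ∪ t, φ y v = 0 := fun v hv => ht v (by simp_all)
    rw [hsum y hy _ ht', ← (h.isBarycentric y hy).sum_eq_one ht',
      ← Finset.sum_sdiff (Finset.subset_union_left (s₁ := s) (s₂ := t)),
      ← Finset.sum_sdiff (f := φ y) (Finset.subset_union_left (s₁ := s) (s₂ := t))]
    have h1 := Finset.sum_nonneg fun v (_ : v ∈ (s ∪ t) \ s) => h0 y hy v
    have h2 := Finset.sum_le_sum fun v (_ : v ∈ (s ∪ t) \ s) => hle y hy v
    constructor <;> linarith
  have hc1 : ContinuousOn (fun y => ∑ v ∈ s, G y v) S :=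
    continuousOn_finsetSum _ fun v _ => hG v
  have hc2 : ContinuousOn (fun y => ∑ v ∈ s, φ y v) S :=
    continuousOn_finsetSum _ fun v _ => h.continuousOn v
  have hc3 := (hc1.add (continuousOn_const (c := (1 : ℝ)) |>.sub hc2)) x hx
  have hc1 := hc1 x hx
  rw [ContinuousWithinAt] at hc1 hc3 ⊢
  simp only [Pi.add_apply, Pi.sub_apply, hs1, sub_self, add_zero] at hc3
  rw [hsum x hx s hs]
  refine tendsto_of_tendsto_of_tendsto_of_le_of_le' hc1 hc3 ?_ ?_
  · filter_upwards [self_mem_nhdsWithin] with y hy using (hbd y hy).1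
  · filter_upwards [self_mem_nhdsWithin] with y hy using (hbd y hy).2

theorem exists_continuousMap (h : K.BarycentricOn φ S) :
    ∃ F : C(S, K.MetricCarrier), ∀ (x : S) (v : ι), (F x).1 v = φ x v :=
  ⟨⟨fun x => (h.isBarycentric x x.2).toCarrier, MetricCarrier.continuous_of_continuous_apply
    fun v => by
      simp only [IsBarycentric.toCarrier_apply]
      exact continuousOn_iff_continuous_domRestrict.1 (h.continuousOn v)⟩,
    fun x v => (h.isBarycentric x x.2).toCarrier_apply v⟩

end BarycentricOn

/-! ### Absolute extensors in terms of coordinate families. -/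

theorem exists_barycentricOn_of_continuousMap {S : Set X} (F : C(S, K.MetricCarrier)) :
    ∃ φ : X → ι → ℝ, K.BarycentricOn φ S ∧ ∀ x : S, φ x = (F x).1 := by
  classical
  refine ⟨fun x => if hx : x ∈ S then (F ⟨x, hx⟩).1 else 0, ⟨fun x hx => ?_, fun v => ?_⟩,
    fun x => by simp⟩
  · simpa [hx] using (F ⟨x, hx⟩).isBarycentric
  · rw [continuousOn_iff_continuous_domRestrict]
    convert (MetricCarrier.continuous_apply v).comp F.continuous using 1
    ext x
    simp

/-- Extension of maps to `|K|_m` over a subset, in terms of barycentric coordinates. -/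
def ExtendsOver (K : PreAbstractSimplicialComplex ι) (A : Set X) : Prop :=
  ∀ C : Set X, IsClosed C → ∀ φ : X → ι → ℝ, K.BarycentricOn φ (A ∩ C) →
    ∃ ψ : X → ι → ℝ, K.BarycentricOn ψ A ∧ EqOn ψ φ (A ∩ C)

theorem extendsOver_of_isAbsoluteExtensorOf {A : Set X}
    (h : IsAbsoluteExtensorOf K.MetricCarrier A) : K.ExtendsOver A := by
  intro C hC φ hφ
  have h1 : K.BarycentricOn (φ ∘ ((↑) : A → X)) ((↑) ⁻¹' C) := by
    refine (hφ.comp continuous_subtype_val).mono fun x hx => ⟨x.2, hx⟩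
  obtain ⟨f, hf⟩ := h1.exists_continuousMap
  obtain ⟨g, hg⟩ := h _ (hC.preimage continuous_subtype_val) f
  obtain ⟨ψ, hψ, hψg⟩ := exists_barycentricOn_of_continuousMap g
  refine ⟨ψ, hψ, fun x hx => ?_⟩
  ext v
  rw [hψg ⟨x, hx.1⟩, hg ⟨⟨x, hx.1⟩, hx.2⟩]
  exact hf ⟨⟨x, hx.1⟩, hx.2⟩ v

theorem isAbsoluteExtensorOf_of_extendsOver_univ (h : K.ExtendsOver (univ : Set X)) :
    IsAbsoluteExtensorOf K.MetricCarrier X := by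
  intro C hC f
  obtain ⟨φ, hφ, hφf⟩ := exists_barycentricOn_of_continuousMap f
  obtain ⟨ψ, hψ, hψφ⟩ := h C hC φ (by rwa [univ_inter])
  obtain ⟨g, hg⟩ := hψ.exists_continuousMap
  refine ⟨g.comp ⟨fun x => ⟨x, mem_univ x⟩, by fun_prop⟩, fun c => ?_⟩
  refine MetricCarrier.ext_apply fun v => ?_
  rw [← hφf c, ← hψφ ⟨mem_univ _, c.2⟩]
  exact hg _ v

end PreAbstractSimplicialComplex

/-! ### Extension from a closed set to a neighbourhood. -/

namespace PreAbstractSimplicialComplex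

variable {ι : Type*} {K L : PreAbstractSimplicialComplex ι} {X : Type*} [TopologicalSpace X]
  [TopologicalSpace.MetrizableSpace X] {φ : X → ι → ℝ} {S D : Set X}

theorem IsBarycentric.sum_mul {β : Type*} {s : Finset β} {w : β → ℝ} {φ : β → ι → ℝ}
    (hw : ∀ i ∈ s, 0 ≤ w i) (hw1 : ∑ i ∈ s, w i = 1) (hφ : ∀ i ∈ s, K.IsBarycentric (φ i)) :
    (⊤ : PreAbstractSimplicialComplex ι).IsBarycentric fun v => ∑ i ∈ s, w i * φ i v := by
  classical
  choose! t ht ht0 ht1 using fun i hi => (hφ i hi).exists_face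
  have hsum : ∑ v ∈ s.biUnion t, ∑ i ∈ s, w i * φ i v = 1 := by
    rw [Finset.sum_comm, ← hw1]
    refine Finset.sum_congr rfl fun i hi => ?_
    rw [← Finset.mul_sum, (hφ i hi).sum_eq_one, mul_one]
    exact fun v hv => ht0 i hi v fun h => hv (Finset.mem_biUnion.2 ⟨i, hi, h⟩)
  refine ⟨fun v => Finset.sum_nonneg fun i hi => mul_nonneg (hw i hi) ((hφ i hi).nonneg v),
    s.biUnion t, ?_, fun v hv => ?_, hsum⟩
  · change (s.biUnion t).Nonempty
    rw [Finset.nonempty_iff_ne_empty]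
    intro h
    simp [h] at hsum
  · refine Finset.sum_eq_zero fun i hi => ?_
    rw [ht0 i hi v fun h => hv (Finset.mem_biUnion.2 ⟨i, hi, h⟩), mul_zero]

open Classical in
/-- Dugundji extension: a map from a closed set to `|K|_m` extends over the whole space to
a map into the full simplex on the vertices of `K`. -/
theorem BarycentricOn.exists_extension_top (hD : IsClosed D) (hne : D.Nonempty)
    (h : K.BarycentricOn φ D) : ∃ Φ : X → ι → ℝ,
      (⊤ : PreAbstractSimplicialComplex ι).BarycentricOn Φ univ ∧ EqOn Φ φ D := by
  let _ := TopologicalSpace.metrizableSpaceMetric X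
  have hpos : ∀ i : (Dᶜ : Set X), 0 < Metric.infDist i.1 D := fun i =>
    (hD.notMem_iff_infDist_pos hne).1 i.2
  -- Let `r` be the distance from `i` to `D`. If `dist y x < δ / 4` with `x ∈ D` and `dist y i < r /
  -- 4`, then `r < δ / 3`, so `dist (a i) x < 2 * r + r / 4 + δ / 4 < δ`.
  obtain ⟨p, hp⟩ := PartitionOfUnity.exists_isSubordinate (X := (Dᶜ : Set X)) isClosed_univ
    (fun i : (Dᶜ : Set X) => {y : (Dᶜ : Set X) | dist y.1 i.1 < Metric.infDist i.1 D / 4})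
    (fun i => isOpen_lt (by fun_prop) continuous_const)
    (fun i _ => mem_iUnion.2 ⟨i, by simpa using hpos i⟩)
  have hnear : ∀ i : (Dᶜ : Set X), ∃ a ∈ D, dist i.1 a < 2 * Metric.infDist i.1 D := fun i =>
    (Metric.infDist_lt_iff hne).1 (by linarith [hpos i])
  choose a haD ha using hnear
  set Ψ : (Dᶜ : Set X) → ι → ℝ := fun y v => ∑ i ∈ p.finsupport y, p i y * φ (a i) v with hΨ
  have hΨc : ∀ v, Continuous fun y => Ψ y v := by
    intro v
    have := hp.continuous_finsum_smul (g := fun i _ => φ (a i) v)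
      (fun i => isOpen_lt (by fun_prop) continuous_const) fun i => continuousOn_const
    convert this using 2 with y
    exact p.sum_finsupport_smul_eq_finsum fun i _ => φ (a i) v
  have hw1 : ∀ y, ∑ i ∈ p.finsupport y, p i y = 1 := fun y => p.sum_finsupport (mem_univ y)
  set Φ : X → ι → ℝ := fun x => if hx : x ∈ Dᶜ then Ψ ⟨x, hx⟩ else φ x with hΦ
  have hΦD : EqOn Φ φ D := fun x hx => by simp [hΦ, hx]
  have hΦC : ∀ y : (Dᶜ : Set X), Φ y = Ψ y := fun y => by
    simp only [hΦ, dif_pos y.2]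
  refine ⟨Φ, ⟨fun x _ => ?_, fun v x _ => ContinuousAt.continuousWithinAt ?_⟩, hΦD⟩
  · by_cases hx : x ∈ D
    · rw [hΦD hx]
      exact (h.isBarycentric x hx).mono fun s hs => (K.isRelLowerSet_faces hs).1
    · rw [hΦC ⟨x, hx⟩]
      exact IsBarycentric.sum_mul (fun i _ => p.nonneg i _) (hw1 _)
        fun i _ => h.isBarycentric _ (haD i)
  · by_cases hx : x ∈ D
    · rw [Metric.continuousAt_iff]
      intro ε hε
      obtain ⟨δ, hδ, hδε⟩ := Metric.continuousWithinAt_iff.1 (h.continuousOn v x hx) ε hε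
      refine ⟨δ / 4, by positivity, fun y hy => ?_⟩
      rw [hΦD hx]
      by_cases hyD : y ∈ D
      · rw [hΦD hyD]
        exact hδε hyD (by linarith)
      · rw [hΦC ⟨y, hyD⟩, ← Metric.mem_ball]
        refine (convex_ball (φ x v) ε).sum_mem (fun i _ => p.nonneg i _) (hw1 ⟨y, hyD⟩)
          fun i hi => hδε (haD i) ?_
        have h1 : dist y i.1 < Metric.infDist i.1 D / 4 :=
          hp i (subset_closure ((p.mem_finsupport _).1 hi))
        have h2 : Metric.infDist i.1 D ≤ dist i.1 x := Metric.infDist_le_dist_of_mem hx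
        have h3 := dist_triangle i.1 y x
        have h4 := dist_triangle_left (a i) x i.1
        have h5 := ha i
        rw [dist_comm i.1 y] at h3
        linarith
    · refine ContinuousOn.continuousAt (s := Dᶜ) ?_ (hD.isOpen_compl.mem_nhds hx)
      rw [continuousOn_iff_continuous_domRestrict]
      convert hΨc v using 1
      ext y
      exact congrFun (hΦC y) v

/-- `|K|_m` is an absolute neighbourhood extensor of metrizable spaces. -/
theorem BarycentricOn.exists_nhds_extension (hD : IsClosed D) (h : K.BarycentricOn φ D) :
    ∃ N : Set X, IsOpen N ∧ D ⊆ N ∧ ∃ ψ : X → ι → ℝ, K.BarycentricOn ψ N ∧ EqOn ψ φ D := by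
  classical
  rcases D.eq_empty_or_nonempty with rfl | hne
  · exact ⟨∅, isOpen_empty, subset_rfl, φ, h, eqOn_refl _ _⟩
  obtain ⟨Φ, hΦ, hΦD⟩ := h.exists_extension_top hD hne
  obtain ⟨F, hF⟩ := hΦ.exists_continuousMap
  set R : Set (⊤ : PreAbstractSimplicialComplex ι).MetricCarrier := {q | K.IsBarycentric q.1}
  set t : X → ℝ := fun x => Metric.infDist (F ⟨x, mem_univ x⟩) R with ht
  have htc : Continuous t := (Metric.continuous_infDist_pt R).comp (by fun_prop)
  have hmem : ∀ x ∈ D, F ⟨x, mem_univ x⟩ ∈ R := by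
    intro x hx
    have : ⇑(F ⟨x, mem_univ x⟩).1 = φ x := by
      ext v
      rw [hF, hΦD hx]
    simpa only [R, mem_ofPred_eq, this] using h.isBarycentric x hx
  have hR : R.Nonempty := hne.elim fun x hx => ⟨_, hmem x hx⟩
  have ht0 : ∀ x, 0 ≤ t x := fun x => Metric.infDist_nonneg
  -- Lowering each coordinate by the distance to `|K|` leaves only vertices that span a face of `K`,
  -- and changes nothing on `D`. Normalizing is possible on the open set where some coordinate
  -- survives.
  set G : X → ι → ℝ := fun x v => max 0 (Φ x v - t x) with hG
  have hGc : ∀ v, Continuous fun x => G x v := fun v =>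
    continuous_const.max ((continuousOn_univ.1 (hΦ.continuousOn v)).sub htc)
  have hGle : ∀ x v, G x v ≤ Φ x v := fun x v =>
    max_le ((hΦ.isBarycentric x (mem_univ x)).nonneg v) (by linarith [ht0 x])
  have hS : Continuous fun x => ∑ᶠ v, G x v := continuousOn_univ.1 <|
    hΦ.continuousOn_finsum (fun v => (hGc v).continuousOn) (fun _ _ _ => le_max_left _ _)
      fun x _ => hGle x
  have hGD : ∀ x ∈ D, G x = φ x := by
    intro x hx
    ext v
    rw [← hΦD hx]
    simp only [hG, ht, Metric.infDist_zero_of_mem (hmem x hx), sub_zero]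
    exact max_eq_right ((hΦ.isBarycentric x (mem_univ x)).nonneg v)
  have hSD : ∀ x ∈ D, ∑ᶠ v, G x v = 1 := by
    intro x hx
    obtain ⟨s, -, hs0, hs1⟩ := (h.isBarycentric x hx).exists_face
    rw [hGD x hx, ← hs1]
    exact finsum_eq_sum_of_support_subset _ fun v hv => by_contra fun hn => hv (hs0 v hn)
  refine ⟨{x | 0 < ∑ᶠ v, G x v}, isOpen_lt continuous_const hS, fun x hx => ?_,
    fun x v => G x v / ∑ᶠ v, G x v, ⟨fun x hx => ?_, fun v => ?_⟩, fun x hx => ?_⟩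
  · simp [hSD x hx]
  · have hx : 0 < ∑ᶠ v, G x v := hx
    refine ⟨fun v => div_nonneg (le_max_left _ _) hx.le, ?_⟩
    obtain ⟨s, -, hs0, -⟩ := (hΦ.isBarycentric x (mem_univ x)).exists_face
    set T := s.filter fun v => t x < Φ x v with hT
    have hT0 : ∀ v ∉ T, G x v = 0 := by
      intro v hv
      by_cases hvs : v ∈ s
      · exact max_eq_left (by simp_all)
      · exact max_eq_left (by linarith [hs0 v hvs, ht0 x])
    have hsum : ∑ᶠ v, G x v = ∑ v ∈ T, G x v :=
      finsum_eq_sum_of_support_subset _ fun v hv => by_contra fun hn => hv (hT0 v hn)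
    have hTne : T.Nonempty := by
      rw [Finset.nonempty_iff_ne_empty]
      intro he
      rw [hsum, he] at hx
      simp at hx
    refine ⟨T, ?_, fun v hv => by rw [hT0 v hv, zero_div], ?_⟩
    -- A point `q` of `|K|` nearer than the least coordinate on `T` is positive on all of `T`, so
    -- `T` lies in a face of `K`.
    · obtain ⟨q, hqR, hq⟩ := (Metric.infDist_lt_iff (x := F ⟨x, mem_univ x⟩) hR
        (r := T.inf' hTne fun v => Φ x v)).1
          ((Finset.lt_inf'_iff _).2 fun v hv => (Finset.mem_filter.1 hv).2)
      obtain ⟨s', hs', hs'0, -⟩ := IsBarycentric.exists_face hqR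
      refine (K.isRelLowerSet_faces hs').2 (fun v hv => ?_) hTne
      by_contra hn
      have h1 := MetricCarrier.abs_apply_sub_le_dist (F ⟨x, mem_univ x⟩) q v
      rw [hs'0 v hn, sub_zero, hF] at h1
      have h2 := Finset.inf'_le (fun v => Φ x v) hv
      have h3 := le_abs_self (Φ x v)
      simp only at h1
      linarith
    · rw [← Finset.sum_div, ← hsum, div_self hx.ne']
  · exact (hGc v).continuousOn.div hS.continuousOn fun x hx => hx.ne'
  · ext v
    change G x v / ∑ᶠ v, G x v = φ x v
    rw [hSD x hx, hGD x hx, div_one]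

end PreAbstractSimplicialComplex

/-! ### Extension from a closed set to an open set containing `A`. -/

namespace PreAbstractSimplicialComplex

variable {ι : Type*} {K L : PreAbstractSimplicialComplex ι} {X : Type*} [TopologicalSpace X]
  [TopologicalSpace.MetrizableSpace X] {φ : X → ι → ℝ} {S D E A O : Set X}

open Classical in
/-- A map from an arbitrary subset to `|K|_m` is contiguous to one that extends to
a neighbourhood. -/
theorem BarycentricOn.exists_contiguous_nhds (h : K.BarycentricOn φ E) :
    ∃ W : Set X, IsOpen W ∧ E ⊆ W ∧ ∃ ψ : X → ι → ℝ, K.BarycentricOn ψ W ∧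
      ∀ x ∈ E, ∀ v, φ x v = 0 → ψ x v = 0 := by
  let _ := TopologicalSpace.metrizableSpaceMetric X
  -- These open sets meet `E` exactly where `φ · v ≠ 0`. If `x` lies in `V v` for all `v ∈ s`, some
  -- `e ∈ E` is nearer to `x` than every zero set, so `s` is in the support of `φ e`: the nerve of
  -- `V` lies in `K`. With `infEDist` an empty zero set is at distance `⊤`.
  set V : ι → Set X := fun v => {x | Metric.infEDist x E < Metric.infEDist x {e ∈ E | φ e v = 0}}
    with hV
  have hVo : ∀ v, IsOpen (V v) := fun v =>
    isOpen_lt Metric.continuous_infEDist Metric.continuous_infEDist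
  set W := ⋃ v, V v with hW
  have hWo : IsOpen W := isOpen_iUnion hVo
  have hface : ∀ x, ∀ s : Finset ι, s.Nonempty → (∀ v ∈ s, x ∈ V v) → s ∈ K.faces := by
    intro x s hs hx
    obtain ⟨e, heE, he⟩ := Metric.infEDist_lt_iff.1 <| (Finset.lt_inf'_iff hs).2 hx
    obtain ⟨t, ht, ht0, -⟩ := (h.isBarycentric e heE).exists_face
    refine (K.isRelLowerSet_faces ht).2 (fun v hv => ?_) hs
    by_contra hn
    exact (he.trans_le (Finset.inf'_le _ hv)).not_ge
      (Metric.infEDist_le_edist_of_mem ⟨heE, ht0 v hn⟩)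
  have hEV : ∀ e ∈ E, ∀ v, e ∈ V v ↔ φ e v ≠ 0 := by
    intro e he v
    have h0 : Metric.infEDist e E = 0 := Metric.infEDist_zero_of_mem he
    refine ⟨fun hev h1 => ?_, fun hev => ?_⟩
    · have h2 : Metric.infEDist e {e ∈ E | φ e v = 0} = 0 := Metric.infEDist_zero_of_mem ⟨he, h1⟩
      simp only [hV, mem_ofPred_eq, h0, h2, lt_self_iff_false] at hev
    · change Metric.infEDist e E < Metric.infEDist e {e ∈ E | φ e v = 0}
      rw [h0, pos_iff_ne_zero, Ne, ← Metric.mem_closure_iff_infEDist_zero]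
      intro hcl
      have := ((h.continuousOn v e he).mono (sep_subset E fun e => φ e v = 0)).mem_closure hcl
        (t := {0}) fun x hx => hx.2
      simp only [closure_singleton, mem_singleton_iff] at this
      exact hev this
  have hEW : E ⊆ W := by
    intro e he
    obtain ⟨s, -, -, hs⟩ := (h.isBarycentric e he).exists_face
    obtain ⟨v, -, hv⟩ := Finset.exists_ne_zero_of_sum_ne_zero (hs.trans_ne one_ne_zero)
    exact mem_iUnion.2 ⟨v, (hEV e he v).2 hv⟩
  -- A partition of unity indexed by the vertices is itself a family of barycentric coordinates,
  -- supported on simplices of the nerve.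
  obtain ⟨p, hp⟩ := PartitionOfUnity.exists_isSubordinate (X := W) isClosed_univ
    (fun v => ((↑) : W → X) ⁻¹' V v) (fun v => (hVo v).preimage continuous_subtype_val)
    (fun x _ => (mem_iUnion.1 x.2).elim fun v hv => mem_iUnion.2 ⟨v, hv⟩)
  have hpV : ∀ x v, p v x ≠ 0 → x.1 ∈ V v := fun x v hv => hp v (subset_closure hv)
  set ψ : X → ι → ℝ := fun x v => if hx : x ∈ W then p v ⟨x, hx⟩ else 0 with hψ
  have hψW : ∀ x : W, ∀ v, ψ x v = p v x := fun x v => by simp only [hψ, dif_pos x.2]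
  refine ⟨W, hWo, hEW, ψ, ⟨fun x hx => ?_, fun v => ?_⟩, fun x hx v hv => ?_⟩
  · have h1 := p.sum_finsupport (mem_univ ⟨x, hx⟩)
    have hsupp : ∀ v, v ∈ p.finsupport ⟨x, hx⟩ ↔ ψ x v ≠ 0 := fun v => by
      rw [p.mem_finsupport, hψW ⟨x, hx⟩ v, Function.mem_support]
    refine ⟨fun v => hψW ⟨x, hx⟩ v ▸ p.nonneg _ _, p.finsupport ⟨x, hx⟩,
      hface x _ ?_ fun v hv => hpV ⟨x, hx⟩ v ((p.mem_finsupport _).1 hv), fun v hv => ?_, ?_⟩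
    · rw [Finset.nonempty_iff_ne_empty]
      intro he
      simp [he] at h1
    · simpa using (hsupp v).not.1 hv
    · rw [← h1]
      exact Finset.sum_congr rfl fun v _ => hψW ⟨x, hx⟩ v
  · rw [continuousOn_iff_continuous_domRestrict]
    convert (p v).continuous using 1
    ext x
    exact hψW x v
  · by_contra hn
    rw [hψW ⟨x, hEW hx⟩] at hn
    exact (hEV x hx v).1 (hpV _ v hn) hv

/-- `O` is exhausted by sets `F n` closed in `X`, and the map is extended over `A ∩ F n` by
induction. Each point of `O` has some `F n` as a neighbourhood, so the limit is continuous. -/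
theorem ExtendsOver.inter_isOpen (hA : K.ExtendsOver A) (hO : IsOpen O) :
    K.ExtendsOver (A ∩ O) := by
  classical
  let _ := TopologicalSpace.metrizableSpaceMetric X
  intro C hC φ hφ
  -- As `0⁻¹ = ⊤`, the set `F 0` is empty unless `O` is the whole space, in which case every `F n`
  -- is.
  set F : ℕ → Set X := fun n => {x | (n : ENNReal)⁻¹ ≤ Metric.infEDist x Oᶜ} with hF
  have hFc : ∀ n, IsClosed (F n) := fun n => isClosed_le continuous_const Metric.continuous_infEDist
  have hFm : Monotone F := fun m n hmn x hx => by
    refine le_trans ?_ (show (m : ENNReal)⁻¹ ≤ _ from hx)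
    exact ENNReal.inv_le_inv.2 (by exact_mod_cast hmn)
  have hFO : ∀ n, F n ⊆ O := by
    intro n x hx
    by_contra hn
    have h0 : Metric.infEDist x Oᶜ = 0 := Metric.infEDist_zero_of_mem hn
    have hx : (n : ENNReal)⁻¹ ≤ Metric.infEDist x Oᶜ := hx
    simp [h0] at hx
  have hOF : ∀ x ∈ O, ∃ n, F n ∈ 𝓝 x := by
    intro x hx
    have hpos : Metric.infEDist x Oᶜ ≠ 0 := by
      rw [Ne, ← Metric.mem_closure_iff_infEDist_zero, hO.isClosed_compl.closure_eq]
      exact fun hn => hn hx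
    obtain ⟨n, hn⟩ := ENNReal.exists_inv_nat_lt hpos
    exact ⟨n, mem_of_superset ((isOpen_lt continuous_const Metric.continuous_infEDist).mem_nhds hn)
      fun y hy => le_of_lt (show (n : ENNReal)⁻¹ < _ from hy)⟩
  have hbase : ∃ ψ, K.BarycentricOn ψ (A ∩ F 0) ∧ EqOn ψ φ (A ∩ F 0 ∩ C) := by
    obtain ⟨ψ, hψ, hψφ⟩ := hA (F 0 ∩ C) ((hFc 0).inter hC) φ
      (hφ.mono fun x hx => ⟨⟨hx.1, hFO 0 hx.2.1⟩, hx.2.2⟩)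
    exact ⟨ψ, hψ.mono inter_subset_left, fun x hx => hψφ ⟨hx.1.1, hx.1.2, hx.2⟩⟩
  have hstep : ∀ n ψ, (K.BarycentricOn ψ (A ∩ F n) ∧ EqOn ψ φ (A ∩ F n ∩ C)) →
      ∃ ψ', (K.BarycentricOn ψ' (A ∩ F (n + 1)) ∧ EqOn ψ' φ (A ∩ F (n + 1) ∩ C)) ∧
        EqOn ψ' ψ (A ∩ F n) := by
    rintro n ψ ⟨hψ, hψφ⟩
    have hglue := hψ.ite_of_isClosed (ψ := φ) (hFc n) ((hFc (n + 1)).inter hC)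
      (hφ.mono fun x hx => ⟨⟨hx.1, hFO _ hx.2.1⟩, hx.2.2⟩)
      (fun x hx => hψφ ⟨hx.1, hx.2.2⟩)
    obtain ⟨ψ', hψ', heq⟩ := hA _ ((hFc n).union ((hFc (n + 1)).inter hC)) _ hglue
    refine ⟨ψ', ⟨hψ'.mono inter_subset_left, fun x hx => ?_⟩, fun x hx => ?_⟩
    · rw [heq ⟨hx.1.1, Or.inr ⟨hx.1.2, hx.2⟩⟩]
      beta_reduce
      split_ifs with hxn
      · exact hψφ ⟨⟨hx.1.1, hxn⟩, hx.2⟩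
      · rfl
    · exact (heq ⟨hx.1, Or.inl hx.2⟩).trans (if_pos hx.2)
  choose! next hnext hnext_eq using hstep
  obtain ⟨ψ₀, hψ₀⟩ := hbase
  let seq : ℕ → X → ι → ℝ := fun n => Nat.rec ψ₀ next n
  have hseq : ∀ n, K.BarycentricOn (seq n) (A ∩ F n) ∧ EqOn (seq n) φ (A ∩ F n ∩ C) := by
    intro n
    induction n with
    | zero => exact hψ₀
    | succ n ih => exact hnext n _ ih
  have hseq_le : ∀ m n, m ≤ n → EqOn (seq n) (seq m) (A ∩ F m) := by
    intro m n hmn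
    induction n, hmn using Nat.le_induction with
    | base => exact eqOn_refl _ _
    | succ n hmn ih =>
      exact fun x hx => (hnext_eq n _ (hseq n) ⟨hx.1, hFm hmn hx.2⟩).trans (ih hx)
  have hex : ∀ x, x ∈ O → ∃ n, x ∈ F n := fun x hx =>
    (hOF x hx).imp fun n hn => mem_of_mem_nhds hn
  choose! N hN using hex
  have hlim : ∀ m, EqOn (fun x => seq (N x) x) (seq m) (A ∩ F m) := by
    intro m x hx
    rcases le_total m (N x) with hle | hle
    · exact hseq_le _ _ hle hx
    · exact (hseq_le _ _ hle ⟨hx.1, hN x (hFO m hx.2)⟩).symm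
  refine ⟨fun x => seq (N x) x, ⟨fun x hx => ?_, fun v x hx => ?_⟩, fun x hx => ?_⟩
  · exact (hseq (N x)).1.isBarycentric x ⟨hx.1, hN x hx.2⟩
  · obtain ⟨m, hm⟩ := hOF x hx.2
    have := ((hseq m).1.congr (hlim m)).continuousOn v x ⟨hx.1, mem_of_mem_nhds hm⟩
    exact ((continuousWithinAt_inter hm).1 this).mono inter_subset_left
  · exact (hseq (N x)).2 ⟨⟨hx.1.1, hN x hx.1.2⟩, hx.2⟩

theorem IsBarycentric.lineMap_of_support {φ ψ : ι → ℝ} (hφ : K.IsBarycentric φ)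
    (hψ : K.IsBarycentric ψ) (h : ∀ v, φ v = 0 → ψ v = 0) {a : ℝ} (ha : a ∈ Icc (0 : ℝ) 1) :
    K.IsBarycentric fun v => a * φ v + (1 - a) * ψ v := by
  obtain ⟨s, hs, h0, h1⟩ := hφ.exists_face
  have := hψ.sum_eq_one fun v hv => h v (h0 v hv)
  refine ⟨fun v => add_nonneg (mul_nonneg ha.1 (hφ.nonneg v))
    (mul_nonneg (sub_nonneg.2 ha.2) (hψ.nonneg v)), s, hs, fun v hv => ?_, ?_⟩
  · simp [h0 v hv, h v (h0 v hv)]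
  · rw [Finset.sum_add_distrib, ← Finset.mul_sum, ← Finset.mul_sum, h1, this]
    ring

/-- If maps to `|K|_m` extend over `A`, then a map from a closed set `D` extends over an open
set that contains `D` and `A`. -/
theorem ExtendsOver.exists_isOpen_extension (hA : K.ExtendsOver A) (hD : IsClosed D)
    (h : K.BarycentricOn φ D) : ∃ W : Set X, IsOpen W ∧ D ⊆ W ∧ A ⊆ W ∧
      ∃ ψ : X → ι → ℝ, K.BarycentricOn ψ W ∧ EqOn ψ φ D := by
  classical
  let _ := TopologicalSpace.metrizableSpaceMetric X
  obtain ⟨N, hN, hDN, f, hf, hfφ⟩ := h.exists_nhds_extension hD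
  obtain ⟨O, hO, hDO, hON⟩ := normal_exists_closure_subset hD hN hDN
  -- `f` on `closure O` and `g` on the part of `A` outside `O` glue to one map on `A ∪ O`, to which
  -- `η` is contiguous.
  obtain ⟨g, hg, hgf⟩ := hA (closure O) isClosed_closure f
    (hf.mono (inter_subset_right.trans hON))
  have hγ := BarycentricOn.ite_of_isClosed (S := A ∪ O) (ψ := g) isClosed_closure hO.isClosed_compl
    (hf.mono (inter_subset_right.trans hON)) (hg.mono fun x hx => hx.1.resolve_right hx.2)
    (fun x hx => (hgf ⟨hx.1.1.resolve_right hx.2, hx.1.2⟩).symm)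
  obtain ⟨W, hW, hEW, η, hη, hcont⟩ := (hγ.mono (T := A ∪ O) fun x hx => ⟨hx, by
    by_cases hxO : x ∈ O
    exacts [Or.inl (subset_closure hxO), Or.inr hxO]⟩).exists_contiguous_nhds
  obtain ⟨α, hα0, hα1, hα⟩ := exists_continuous_zero_one_of_isClosed hO.isClosed_compl hD
    (disjoint_compl_left_iff_subset.2 hDO)
  have hON' : O ⊆ N := subset_closure.trans hON
  refine ⟨W, hW, hDO.trans (subset_union_right.trans hEW), subset_union_left.trans hEW,
    fun x v => α x * f x v + (1 - α x) * η x v, ⟨fun x hx => ?_, fun v => ?_⟩, fun x hx => ?_⟩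
  -- On `O` the glued map is `f`, so `η` is supported in the simplex of `f` and the segment stays in
  -- `|K|`. Off `O` the weight of `f` is 0.
  · by_cases hxO : x ∈ O
    · refine (hf.isBarycentric x (hON' hxO)).lineMap_of_support (hη.isBarycentric x hx)
        (fun v hv => hcont x (Or.inr hxO) v ?_) (hα x)
      rwa [if_pos (subset_closure hxO)]
    · simpa [show α x = 0 from hα0 hxO] using hη.isBarycentric x hx
  · refine ContinuousOn.add (Continuous.continuousOn ?_) (ContinuousOn.mul ?_ (hη.continuousOn v))
    · refine α.continuous.mul_of_continuousOn_of_abs_le_one hO (fun x hx => hα0 hx)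
        ((hf.continuousOn v).mono hON') fun x hx => ?_
      have := hf.isBarycentric x (hON' hx)
      rw [abs_of_nonneg (this.nonneg v)]
      exact this.le_one v
    · fun_prop
  · ext v
    simp [show α x = 1 from hα1 hx, hfφ hx]

end PreAbstractSimplicialComplex

/-! ### Open subspaces, coordinates on the join, and the extension. -/

namespace PreAbstractSimplicialComplex

variable {ι κ : Type*} {K : PreAbstractSimplicialComplex ι} {L : PreAbstractSimplicialComplex κ}
  {X : Type*} [TopologicalSpace X]

theorem BarycentricOn.exists_image_val {U : Set X} {φ : U → ι → ℝ} {S : Set U}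
    (h : K.BarycentricOn φ S) : ∃ ψ : X → ι → ℝ, K.BarycentricOn ψ ((↑) '' S) ∧
      ∀ x : U, ψ x = φ x := by
  classical
  set ψ : X → ι → ℝ := fun x => if hx : x ∈ U then φ ⟨x, hx⟩ else 0 with hψ
  have hext : ∀ x : U, ψ x = φ x := fun x => by simp [hψ]
  refine ⟨ψ, ⟨?_, fun v => IsInducing.subtypeVal.continuousOn_image_iff.2 ?_⟩, hext⟩
  · rintro _ ⟨x, hx, rfl⟩
    rw [hext]
    exact h.isBarycentric x hx
  · exact (h.continuousOn v).congr fun x _ => congrFun (hext x) v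

/-- `C ∩ U` need not be closed in `X`, so the previous extension is made in the subspace `U`; sets
open in `U` are open in `X`. -/
theorem ExtendsOver.exists_isOpen_extension_of_isOpen [TopologicalSpace.MetrizableSpace X]
    {A C U : Set X} {φ : X → ι → ℝ} (hA : K.ExtendsOver A) (hU : IsOpen U) (hC : IsClosed C)
    (h : K.BarycentricOn φ (C ∩ U)) : ∃ W : Set X, IsOpen W ∧ C ∩ U ⊆ W ∧ A ∩ U ⊆ W ∧
      ∃ ψ : X → ι → ℝ, K.BarycentricOn ψ W ∧ EqOn ψ φ (C ∩ U) := by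
  have hAU : K.ExtendsOver (((↑) : U → X) ⁻¹' A) := by
    intro D hD f hf
    obtain ⟨D', hD', rfl⟩ := isClosed_induced_iff.1 hD
    obtain ⟨g, hg, hgf⟩ := hf.exists_image_val
    obtain ⟨ψ, hψ, hψg⟩ := hA.inter_isOpen hU D' hD' g
      (hg.mono fun x hx => ⟨⟨x, hx.1.2⟩, ⟨hx.1.1, hx.2⟩, rfl⟩)
    refine ⟨ψ ∘ (↑), (hψ.comp continuous_subtype_val).mono fun x hx => ⟨hx, x.2⟩, fun x hx => ?_⟩
    rw [Function.comp_apply, hψg ⟨⟨hx.1, x.2⟩, hx.2⟩, hgf]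
  obtain ⟨W, hW, hCW, hAW, ψ, hψ, hψφ⟩ := hAU.exists_isOpen_extension
    (hC.preimage continuous_subtype_val) ((h.comp continuous_subtype_val).mono
      fun x hx => ⟨hx, x.2⟩)
  obtain ⟨η, hη, hηψ⟩ := hψ.exists_image_val
  refine ⟨_, hU.isOpenMap_subtype_val W hW, fun x hx => ⟨⟨x, hx.2⟩, hCW hx.1, rfl⟩,
    fun x hx => ⟨⟨x, hx.2⟩, hAW hx.1, rfl⟩, η, hη, fun x hx => ?_⟩
  rw [hηψ ⟨x, hx.2⟩]
  exact hψφ (show (⟨x, hx.2⟩ : U) ∈ _ from hx.1)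

/-- The total weight of the coordinates indexed by `ι`. -/
noncomputable def leftWeight (φ : ι ⊕ κ → ℝ) : ℝ :=
  ∑ᶠ w : ι ⊕ κ, Sum.elim (fun v => φ (Sum.inl v)) (fun _ => 0) w

theorem BarycentricOn.continuousOn_leftWeight {J : PreAbstractSimplicialComplex (ι ⊕ κ)}
    {φ : X → ι ⊕ κ → ℝ} {S : Set X} (h : J.BarycentricOn φ S) :
    ContinuousOn (fun x => leftWeight (φ x)) S := by
  refine h.continuousOn_finsum (G := fun x => Sum.elim (fun v => φ x (Sum.inl v)) fun _ => 0)
    ?_ ?_ ?_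
  · rintro (v | w)
    · exact h.continuousOn _
    · exact continuousOn_const
  · rintro x hx (v | w)
    · exact (h.isBarycentric x hx).nonneg _
    · exact le_rfl
  · rintro x hx (v | w)
    · exact le_rfl
    · exact (h.isBarycentric x hx).nonneg _

namespace IsBarycentric

variable {φ : ι ⊕ κ → ℝ}

theorem exists_face_join (h : (K.join L).IsBarycentric φ) : ∃ s t,
    (s = ∅ ∨ s ∈ K.faces) ∧ (t = ∅ ∨ t ∈ L.faces) ∧ (∀ v ∉ s, φ (Sum.inl v) = 0) ∧
    (∀ w ∉ t, φ (Sum.inr w) = 0) ∧ ∑ v ∈ s, φ (Sum.inl v) = leftWeight φ ∧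
    ∑ w ∈ t, φ (Sum.inr w) = 1 - leftWeight φ := by
  obtain ⟨T, ⟨-, hK, hL⟩, h0, h1⟩ := h.exists_face
  have h2 : leftWeight φ = ∑ v ∈ T.toLeft, φ (Sum.inl v) := by
    rw [leftWeight, finsum_eq_sum_of_support_subset (s := T),
      Finset.sum_sum_eq_sum_toLeft_add_sum_toRight]
    · simp
    · rintro (v | w) hv
      · exact by_contra fun hn => hv (h0 _ hn)
      · exact absurd rfl hv
  rw [Finset.sum_sum_eq_sum_toLeft_add_sum_toRight] at h1
  exact ⟨T.toLeft, T.toRight, hK, hL, fun v hv => h0 _ fun hn => hv (Finset.mem_toLeft.2 hn),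
    fun v hv => h0 _ fun hn => hv (Finset.mem_toRight.2 hn), h2.symm, by linarith⟩

theorem leftWeight_mem_Icc (h : (K.join L).IsBarycentric φ) : leftWeight φ ∈ Icc (0 : ℝ) 1 := by
  obtain ⟨s, t, -, -, -, -, hs, ht⟩ := h.exists_face_join
  have h1 := Finset.sum_nonneg fun v (_ : v ∈ s) => h.nonneg (Sum.inl v)
  have h2 := Finset.sum_nonneg fun v (_ : v ∈ t) => h.nonneg (Sum.inr v)
  constructor <;> linarith

theorem div_leftWeight (h : (K.join L).IsBarycentric φ) (h0 : leftWeight φ ≠ 0) :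
    K.IsBarycentric fun v => φ (Sum.inl v) / leftWeight φ := by
  obtain ⟨s, t, hs, -, hs0, -, hs1, -⟩ := h.exists_face_join
  refine ⟨fun v => div_nonneg (h.nonneg _) h.leftWeight_mem_Icc.1, s, hs.resolve_left ?_,
    fun v hv => by rw [hs0 v hv, zero_div], by rw [← Finset.sum_div, hs1, div_self h0]⟩
  rintro rfl
  exact h0 hs1.symm

theorem div_one_sub_leftWeight (h : (K.join L).IsBarycentric φ) (h1 : leftWeight φ ≠ 1) :
    L.IsBarycentric fun w => φ (Sum.inr w) / (1 - leftWeight φ) := by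
  obtain ⟨s, t, -, ht, -, ht0, -, ht1⟩ := h.exists_face_join
  have hne : 1 - leftWeight φ ≠ 0 := sub_ne_zero.2 h1.symm
  refine ⟨fun v => div_nonneg (h.nonneg _) (sub_nonneg.2 h.leftWeight_mem_Icc.2), t,
    ht.resolve_left ?_, fun v hv => by rw [ht0 v hv, zero_div],
    by rw [← Finset.sum_div, ht1, div_self hne]⟩
  rintro rfl
  exact hne ht1.symm

theorem inl_eq_zero (h : (K.join L).IsBarycentric φ) (h0 : leftWeight φ = 0) (v : ι) :
    φ (Sum.inl v) = 0 := by
  obtain ⟨s, t, -, -, hs0, -, hs1, -⟩ := h.exists_face_join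
  by_cases hv : v ∈ s
  · exact (Finset.sum_eq_zero_iff_of_nonneg fun _ _ => h.nonneg _).1 (hs1.trans h0) v hv
  · exact hs0 v hv

theorem inr_eq_zero (h : (K.join L).IsBarycentric φ) (h1 : leftWeight φ = 1) (w : κ) :
    φ (Sum.inr w) = 0 := by
  obtain ⟨s, t, -, -, -, ht0, -, ht1⟩ := h.exists_face_join
  by_cases hw : w ∈ t
  · exact (Finset.sum_eq_zero_iff_of_nonneg fun _ _ => h.nonneg _).1 (by rw [ht1, h1, sub_self])
      w hw
  · exact ht0 w hw

/-- A part of weight 0 contributes the empty simplex, so its coordinates may be arbitrary. -/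
theorem join {a : ℝ} (ha : a ∈ Icc (0 : ℝ) 1) {g : ι → ℝ} {h : κ → ℝ}
    (hg : a ≠ 0 → K.IsBarycentric g) (hh : a ≠ 1 → L.IsBarycentric h) :
    (K.join L).IsBarycentric (Sum.elim (fun v => a * g v) fun w => (1 - a) * h w) := by
  have hs : ∃ s : Finset ι, (s = ∅ ∨ s ∈ K.faces) ∧ (∀ v ∉ s, a * g v = 0) ∧
      ∑ v ∈ s, a * g v = a := by
    by_cases h0 : a = 0
    · exact ⟨∅, Or.inl rfl, by simp [h0], by simp [h0]⟩
    · obtain ⟨s, hs, hs0, hs1⟩ := (hg h0).exists_face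
      exact ⟨s, Or.inr hs, fun v hv => by simp [hs0 v hv], by rw [← Finset.mul_sum, hs1, mul_one]⟩
  have ht : ∃ t : Finset κ, (t = ∅ ∨ t ∈ L.faces) ∧ (∀ w ∉ t, (1 - a) * h w = 0) ∧
      ∑ w ∈ t, (1 - a) * h w = 1 - a := by
    by_cases h0 : a = 1
    · exact ⟨∅, Or.inl rfl, by simp [h0], by simp [h0]⟩
    · obtain ⟨t, ht, ht0, ht1⟩ := (hh h0).exists_face
      exact ⟨t, Or.inr ht, fun v hv => by simp [ht0 v hv], by rw [← Finset.mul_sum, ht1, mul_one]⟩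
  obtain ⟨s, hs, hs0, hs1⟩ := hs
  obtain ⟨t, ht, ht0, ht1⟩ := ht
  have hsum : ∑ w ∈ s.disjSum t, Sum.elim (fun v => a * g v) (fun w => (1 - a) * h w) w = 1 := by
    rw [Finset.sum_disjSum]
    simp only [Sum.elim_inl, Sum.elim_inr, hs1, ht1]
    ring
  refine ⟨?_, s.disjSum t, ⟨?_, by simpa using hs, by simpa using ht⟩, ?_, hsum⟩
  · rintro (v | w)
    · by_cases h0 : a = 0
      · simp [h0]
      · exact mul_nonneg ha.1 ((hg h0).nonneg v)
    · by_cases h0 : a = 1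
      · simp [h0]
      · exact mul_nonneg (sub_nonneg.2 ha.2) ((hh h0).nonneg w)
  · rw [Finset.nonempty_iff_ne_empty]
    intro he
    rw [he] at hsum
    simp at hsum
  · rintro (v | w) hv
    · exact hs0 v fun hn => hv (Finset.inl_mem_disjSum.2 hn)
    · exact ht0 w fun hn => hv (Finset.inr_mem_disjSum.2 hn)

end IsBarycentric

theorem ExtendsOver.join [TopologicalSpace.MetrizableSpace X] {A B : Set X}
    (hA : K.ExtendsOver A) (hB : L.ExtendsOver B) (hAB : A ∪ B = univ) :
    (K.join L).ExtendsOver (univ : Set X) := by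
  classical
  let _ := TopologicalSpace.metrizableSpaceMetric X
  intro C hC φ hφ
  rw [univ_inter] at hφ ⊢
  set σ : X → ℝ := fun x => leftWeight (φ x) with hσ
  have hσc : ContinuousOn σ C := hφ.continuousOn_leftWeight
  have hσI : ∀ x ∈ C, σ x ∈ Icc (0 : ℝ) 1 := fun x hx => (hφ.isBarycentric x hx).leftWeight_mem_Icc
  have hZ : ∀ a : ℝ, IsClosed (C ∩ σ ⁻¹' {a}) := fun a =>
    hσc.preimage_isClosed_of_isClosed hC isClosed_singleton
  have hne : ∀ a : ℝ, ∀ x ∈ C ∩ (C ∩ σ ⁻¹' {a})ᶜ, σ x ≠ a := fun a x hx ha => hx.2 ⟨hx.1, ha⟩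
  obtain ⟨W₀, hW₀, hCW₀, hAW₀, G, hG, hGφ⟩ := hA.exists_isOpen_extension_of_isOpen
    (hZ 0).isOpen_compl hC (φ := fun x v => φ x (Sum.inl v) / σ x)
    ⟨fun x hx => (hφ.isBarycentric x hx.1).div_leftWeight (hne 0 x hx),
      fun v => ((hφ.continuousOn _).mono inter_subset_left).div (hσc.mono inter_subset_left)
        (hne 0)⟩
  obtain ⟨W₁, hW₁, hCW₁, hBW₁, H, hH, hHφ⟩ := hB.exists_isOpen_extension_of_isOpen
    (hZ 1).isOpen_compl hC (φ := fun x w => φ x (Sum.inr w) / (1 - σ x))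
    ⟨fun x hx => (hφ.isBarycentric x hx.1).div_one_sub_leftWeight (hne 1 x hx),
      fun v => ((hφ.continuousOn _).mono inter_subset_left).div
        (continuousOn_const.sub (hσc.mono inter_subset_left))
        fun x hx => sub_ne_zero.2 (hne 1 x hx).symm⟩
  have hC0 : ∀ x ∈ C, x ∉ W₀ → σ x = 0 := fun x hx hn =>
    by_contra fun h0 => hn (hCW₀ ⟨hx, fun h => h0 h.2⟩)
  have hC1 : ∀ x ∈ C, x ∉ W₁ → σ x = 1 := fun x hx hn =>
    by_contra fun h0 => hn (hCW₁ ⟨hx, fun h => h0 h.2⟩)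
  -- A point of `C` outside both sets would have `σ` equal to 0 and 1. A point off `C` lies in `U₀`
  -- and `U₁`, and in `A` or `B`.
  have hcover : ∀ x, x ∉ W₁ → x ∈ W₀ := by
    intro x h1
    by_contra h0
    by_cases hx : x ∈ C
    · exact zero_ne_one ((hC0 x hx h0).symm.trans (hC1 x hx h1))
    · rcases hAB.symm.subset (mem_univ x) with h | h
      · exact h0 (hAW₀ ⟨h, fun hn => hx hn.1⟩)
      · exact h1 (hBW₁ ⟨h, fun hn => hx hn.1⟩)
  -- Only the values on the closed set `C ∪ W₀ᶜ ∪ W₁ᶜ` matter: `σ`, 0 and 1 on the three pieces,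
  -- which agree on overlaps.
  set τ : X → ℝ := fun x => if x ∈ C then σ x else if x ∈ W₀ then 1 else 0 with hτ
  have hτC : EqOn τ σ C := fun x hx => if_pos hx
  have hτ0 : ∀ x ∉ W₀, τ x = 0 := by
    intro x hx
    by_cases hxC : x ∈ C
    · exact (hτC hxC).trans (hC0 x hxC hx)
    · simp [hτ, hxC, hx]
  have hτ1 : ∀ x ∉ W₁, τ x = 1 := by
    intro x hx
    by_cases hxC : x ∈ C
    · exact (hτC hxC).trans (hC1 x hxC hx)
    · simp [hτ, hxC, hcover x hx]
  have hτc : ContinuousOn τ (C ∪ (W₀ᶜ ∪ W₁ᶜ)) :=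
    (hσc.congr hτC).union_of_isClosed
      ((continuousOn_const.congr hτ0).union_of_isClosed (continuousOn_const.congr hτ1)
        hW₀.isClosed_compl hW₁.isClosed_compl)
      hC (hW₀.isClosed_compl.union hW₁.isClosed_compl)
  have hτI : ∀ x, τ x ∈ Icc (0 : ℝ) 1 := by
    intro x
    simp only [hτ]
    split_ifs with h1 h2
    exacts [hσI x h1, ⟨zero_le_one, le_rfl⟩, ⟨le_rfl, zero_le_one⟩]
  obtain ⟨α, hαI, hα⟩ := ContinuousMap.exists_restrict_eq_forall_mem_of_closed
    ⟨_, continuousOn_iff_continuous_domRestrict.1 hτc⟩ (fun x => hτI x.1) ⟨0, by simp⟩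
    (hC.union (hW₀.isClosed_compl.union hW₁.isClosed_compl))
  have hατ : EqOn α τ (C ∪ (W₀ᶜ ∪ W₁ᶜ)) := fun x hx => DFunLike.congr_fun hα ⟨x, hx⟩
  have hα0 : ∀ x ∉ W₀, α x = 0 := fun x hx => (hατ (Or.inr (Or.inl hx))).trans (hτ0 x hx)
  have hα1 : ∀ x ∉ W₁, 1 - α x = 0 := fun x hx => by
    rw [hατ (Or.inr (Or.inr hx)), hτ1 x hx, sub_self]
  refine ⟨fun x => Sum.elim (fun v => α x * G x v) fun w => (1 - α x) * H x w,
    ⟨fun x _ => ?_, ?_⟩, fun x hx => ?_⟩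
  · refine IsBarycentric.join (hαI x) (fun h => hG.isBarycentric x ?_)
      fun h => hH.isBarycentric x ?_
    · exact by_contra fun hn => h (hα0 x hn)
    · exact by_contra fun hn => h (sub_eq_zero.1 (hα1 x hn)).symm
  · rintro (v | w)
    · refine (α.continuous.mul_of_continuousOn_of_abs_le_one hW₀ hα0 (hG.continuousOn v)
        fun x hx => ?_).continuousOn
      rw [abs_of_nonneg ((hG.isBarycentric x hx).nonneg v)]
      exact (hG.isBarycentric x hx).le_one v
    · refine (Continuous.mul_of_continuousOn_of_abs_le_one (by fun_prop) hW₁ hα1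
        (hH.continuousOn w) fun x hx => ?_).continuousOn
      rw [abs_of_nonneg ((hH.isBarycentric x hx).nonneg w)]
      exact (hH.isBarycentric x hx).le_one w
  · have hασ : α x = σ x := (hατ (Or.inl hx)).trans (hτC hx)
    ext (v | w)
    · by_cases h0 : σ x = 0
      · simp [hασ, h0, (hφ.isBarycentric x hx).inl_eq_zero h0 v]
      · have := congrFun (hGφ ⟨hx, fun hn => h0 hn.2⟩) v
        simp only [Sum.elim_inl, hασ, this, mul_div_cancel₀ _ h0]
    · by_cases h1 : σ x = 1
      · simp [hασ, h1, (hφ.isBarycentric x hx).inr_eq_zero h1 w]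
      · have := congrFun (hHφ ⟨hx, fun hn => h1 hn.2⟩) w
        simp only [Sum.elim_inr, hασ, this, mul_div_cancel₀ _ (sub_ne_zero.2 (Ne.symm h1))]

end PreAbstractSimplicialComplex

theorem corollary6p13 {X : Type*} [TopologicalSpace X] [TopologicalSpace.MetrizableSpace X]
    {ι κ : Type*} (K : PreAbstractSimplicialComplex ι) (L : PreAbstractSimplicialComplex κ)
    (A B : Set X) (hAB : A ∪ B = Set.univ)
    (hA : IsAbsoluteExtensorOf K.MetricCarrier A)
    (hB : IsAbsoluteExtensorOf L.MetricCarrier B) :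
    IsAbsoluteExtensorOf (K.join L).MetricCarrier X :=
  PreAbstractSimplicialComplex.isAbsoluteExtensorOf_of_extendsOver_univ <|
    (PreAbstractSimplicialComplex.extendsOver_of_isAbsoluteExtensorOf hA).join
      (PreAbstractSimplicialComplex.extendsOver_of_isAbsoluteExtensorOf hB) hAB
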